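/- Let $G$ be a metric graph, i.e. the compact space obtained from a finite connected multigraph $(V,E)$ (loops and multiple edges allowed) with at least one edge and with edge lengths $\ell\colon E\to(0,\infty)$, by identifying every edge $e$ with the interval $[0,\ell(e)]$ and gluing endpoints at common vertices. Let $L(G)=\sum_{e\in E}\ell(e)$ be its total length, let $\varrho(x,y)$ be the path metric (the arc length of a shortest path from $x$ to $y$), and let $\operatorname{diam}(G)=\max_{x,y\in G}\varrho(x,y)$. Let $H^1(G)$ be the space of continuous functions $f\colon G\to\mathbb R$ whose restriction to every edge $e$ lies in $H^1((0,\ell(e)))$, and put $q(f,g)=\int_G f'g'\,dx$. For a Borel probability measure $\mu$ on $G$, let $H^1(G,\mu)$ be the space of all $f\in H^1(G)$ that are harmonic on $G\setminus\operatorname{supp}\mu$, i.e. satisfy $q(f,g)=0$ for all $g\in H^1(G)$ vanishing on $\operatorname{supp}\mu$. Let $H_\mu$ be the non-negative self-adjoint operator in $L^2(G,\mu)$ associated with the form $q$ on $H^1(G,\mu)$: $f\in\operatorname{dom}(H_\mu)$ and $H_\mu f=g\in L^2(G,\mu)$ if and only if $f\in H^1(G,\mu)$ and $q(f,\varphi)=\int_G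 g\varphi\,d\mu$ for all $\varphi\in H^1(G,\mu)$. Let $0=\lambda_0(H_\mu)<\lambda_1(H_\mu)\le\lambda_2(H_\mu)\le\cdots$ be its eigenvalues counted with multiplicity, with $\lambda_k(H_\mu):=+\infty$ for $k\ge\dim L^2(G,\mu)$. Define $$\lambda_1^{\min}(G):=\min_{\mu}\lambda_1(H_\mu),$$ where $\mu$ runs over all Borel probability measures on $G$. Then this minimum is attained, and $$\frac{4L(G)}{\operatorname{diam}(G)^2}\;\ge\;\lambda_1^{\min}(G)\;\ge\;\frac{4}{\operatorname{diam}(G)}.$$ -/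

import Mathlib

open MeasureTheory Set
open scoped ContDiff

noncomputable section

/-- `g` is a weak (distributional) derivative of `u` on the interval `(a, b)`, tested against
smooth functions with compact support contained in `(a, b)`. -/
def HasWeakDerivOn (a b : ℝ) (u g : ℝ → ℝ) : Prop :=
  ∀ φ : ℝ → ℝ, ContDiff ℝ ∞ φ → HasCompactSupport φ → tsupport φ ⊆ Ioo a b →
    ∫ x in Ioo a b, u x * deriv φ x = - ∫ x in Ioo a b, g x * φ x

/-- The Sobolev space `H¹((a, b))`: functions in `L²((a, b))` with a weak derivative in
`L²((a, b))`. -/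
def MemSobolevH1 (a b : ℝ) (u : ℝ → ℝ) : Prop :=
  MemLp u 2 (volume.restrict (Ioo a b)) ∧
    ∃ g : ℝ → ℝ, MemLp g 2 (volume.restrict (Ioo a b)) ∧ HasWeakDerivOn a b u g

open Classical in
/-- The weak derivative in `L²((a, b))` of a function in `H¹((a, b))` (a representative of the
almost everywhere unique one; the value is `0` for functions outside `H¹((a, b))`). -/
def weakDerivOn (a b : ℝ) (u : ℝ → ℝ) : ℝ → ℝ :=
  if h : MemSobolevH1 a b u then h.2.choose else 0

/-- (A model of) a metric graph: a connected multigraph, loops and multiple edges allowed, with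
vertices `V` and edges `E`, an (arbitrary) orientation of each edge, and positive edge lengths.
Finiteness of `V` and `E` is imposed separately. -/
structure MetricGraph (V : Type*) (E : Type*) where
  /-- the initial vertex of an edge -/
  src : E → V
  /-- the terminal vertex of an edge -/
  tgt : E → V
  /-- the length of an edge -/
  len : E → ℝ
  len_pos : ∀ e, 0 < len e
  connected : ∀ u v : V, Relation.EqvGen (fun a b => ∃ e, src e = a ∧ tgt e = b) u v

namespace MetricGraph

variable {V : Type*} {E : Type*} (G : MetricGraph V E)

/-- The gluing relation on the disjoint union of `V` and the intervals `[0, len e]`: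
the left and right endpoint of the interval of `e` are identified with the initial and
terminal vertex of `e`. -/
inductive Glue : (V ⊕ (Σ e : E, Icc (0 : ℝ) (G.len e))) →
    (V ⊕ (Σ e : E, Icc (0 : ℝ) (G.len e))) → Prop
  | left (e : E) : Glue (Sum.inr ⟨e, ⟨0, left_mem_Icc.2 (G.len_pos e).le⟩⟩) (Sum.inl (G.src e))
  | right (e : E) :
      Glue (Sum.inr ⟨e, ⟨G.len e, right_mem_Icc.2 (G.len_pos e).le⟩⟩) (Sum.inl (G.tgt e))

/-- The points of the metric graph (its metric realization): the quotient of the disjoint union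
of the vertices and the edge intervals by the gluing relation. -/
def Point : Type _ := Quot G.Glue

/-- The point on the edge `e` at position `t ∈ [0, len e]`. -/
def edge (e : E) (t : Icc (0 : ℝ) (G.len e)) : G.Point := Quot.mk _ (Sum.inr ⟨e, t⟩)

/-- The quotient topology: the vertices being discrete, it is the finest topology for which
all edge maps `[0, len e] → G` are continuous. -/
instance : TopologicalSpace G.Point :=
  ⨆ e, TopologicalSpace.coinduced (G.edge e) inferInstance

instance : MeasurableSpace G.Point := borel G.Point

instance : BorelSpace G.Point := ⟨rfl⟩

/-- `G.PathOfLength x y s`: there is a path from `x` to `y` of arc length `s`, that is, a finite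
concatenation of segments of edges, each traversed in either direction, with total length `s`. -/
inductive PathOfLength : G.Point → G.Point → ℝ → Prop
  | refl (x : G.Point) : PathOfLength x x 0
  | cons (e : E) (t t' : Icc (0 : ℝ) (G.len e)) (y : G.Point) (s : ℝ) :
      PathOfLength (G.edge e t') y s →
      PathOfLength (G.edge e t) y (|(t : ℝ) - (t' : ℝ)| + s)

/-- The path metric. -/
def pathDist (x y : G.Point) : ℝ := sInf {s | G.PathOfLength x y s}

/-- The diameter with respect to the path metric. -/
def pathDiam : ℝ := sSup {d | ∃ x y : G.Point, d = G.pathDist x y}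

/-- The total length. -/
def totalLength [Fintype E] : ℝ := ∑ e, G.len e

/-- The restriction of a function on `G` to the edge `e`, as a function of the position in
`[0, len e]` (extended to `ℝ` by its boundary values). -/
def restrictEdge (f : G.Point → ℝ) (e : E) (s : ℝ) : ℝ :=
  f (G.edge e (projIcc 0 (G.len e) (G.len_pos e).le s))

/-- The Sobolev space `H¹(G)`: continuous functions on `G` that are `H¹` on every edge. -/
def H1 : Set (G.Point → ℝ) :=
  {f | Continuous f ∧ ∀ e, MemSobolevH1 0 (G.len e) (G.restrictEdge f e)}

/-- The energy form `q(f, g) = ∫_G f' g' dx`. -/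
def energy [Fintype E] (f g : G.Point → ℝ) : ℝ :=
  ∑ e, ∫ s in Ioo 0 (G.len e),
    weakDerivOn 0 (G.len e) (G.restrictEdge f e) s * weakDerivOn 0 (G.len e) (G.restrictEdge g e) s

/-- `f ∈ H¹(G)` is harmonic on `O`. -/
def IsHarmonicOn [Fintype E] (f : G.Point → ℝ) (O : Set G.Point) : Prop :=
  f ∈ G.H1 ∧ ∀ g ∈ G.H1, (∀ x ∉ O, g x = 0) → G.energy f g = 0

/-- The space `H¹(G, μ)` of functions in `H¹(G)` that are harmonic outside the support of `μ`. -/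
def H1Measure [Fintype E] (μ : Measure G.Point) : Set (G.Point → ℝ) :=
  {f | f ∈ G.H1 ∧ G.IsHarmonicOn f μ.supportᶜ}

/-- The graph of the Laplacian `H_μ`, the self-adjoint operator in `L²(G, μ)` associated with the
form `q` on `H¹(G, μ)`: `G.IsLaplacian μ f g` says that `f ∈ dom(H_μ)` and `H_μ f = g`. -/
def IsLaplacian [Fintype E] (μ : Measure G.Point) (f g : G.Point → ℝ) : Prop :=
  f ∈ G.H1Measure μ ∧ MemLp g 2 μ ∧ ∀ φ ∈ G.H1Measure μ, G.energy f φ = ∫ x, g x * φ x ∂μ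

/-- `f` is an eigenfunction of `H_μ` for the eigenvalue `s`. (As a function in `H¹(G, μ)` is
determined by its class in `L²(G, μ)`, eigenfunctions are regarded as elements of `H¹(G, μ)`.) -/
def IsEigenfunction [Fintype E] (μ : Measure G.Point) (s : ℝ) (f : G.Point → ℝ) : Prop :=
  f ≠ 0 ∧ G.IsLaplacian μ f (s • f)

/-- The eigenvalue `λ_k(H_μ)`, `k = 0, 1, 2, …`, in the increasing enumeration of the eigenvalues of
`H_μ` counted with multiplicity: the least `t` such that there are `k + 1` linearly independent
eigenfunctions with eigenvalues at most `t`, and `+∞` if there is no such `t`. -/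
def eigenvalue [Fintype E] (μ : Measure G.Point) (k : ℕ) : EReal :=
  sInf {T : EReal | ∃ t : ℝ, T = t ∧ ∃ f : Fin (k + 1) → G.Point → ℝ,
    LinearIndependent ℝ f ∧ ∀ i, ∃ s ≤ t, G.IsEigenfunction μ s (f i)}

/-- The optimal eigenvalue `λ_k^min(G)`: the infimum of `λ_k(H_μ)` over all Borel probability
measures `μ` on `G`. -/
def optimalEigenvalue [Fintype E] (k : ℕ) : EReal :=
  ⨅ μ : ProbabilityMeasure G.Point, G.eigenvalue (μ : Measure G.Point) k

end MetricGraph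

end

/-! The minimum has a closed form: `λ₁^min(G) = 4 / R`, where `R` is the largest effective
resistance between two points. The resistance `r(x, y)` is the best constant in `(f x - f y)² ≤ r(x,
y) q(f, f)`.

Lower bound: an eigenfunction `f` with eigenvalue `s ≠ 0` has mean zero, its values lie in an
interval of length `√(R q(f, f))`, and Popoviciu's variance inequality gives `∫ f² dμ ≤ R q(f, f) /
4 = (R s / 4) ∫ f² dμ` (`integral_sq_le`, `IsEigenfunction.eq_zero_or_le`). Equality holds for mass
`1/2` at each of two points `x, y` with `r(x, y) = R`: the potential of a unit current from `x` to
`y`, shifted to the values `± R/2` there, is an eigenfunction for `4 / R`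
(`isEigenfunction_centeredDipole`). Such points exist by compactness.

It remains to compare `R` with the diameter. Resistance satisfies the triangle inequality and is at
most the length of a segment of an edge, so it is at most the path distance, whence `R ≤ diam`.
Conversely, the distance to `y` is 1-Lipschitz along edges and has energy at most `L`; testing with
it gives `ϱ(x, y)² ≤ r(x, y) L`, whence `diam² ≤ R L`.

The potentials come from Hilbert space theory: gradients form a closed subspace of the `L²` vector
fields, and `f ↦ f x - f y` is the pairing of the gradient with a field carried by a path from `y`
to `x`. -/

/-! ### Sobolev functions on an interval -/

theorem eq_zero_of_tsupport_subset_Ioo {a b : ℝ} {φ : ℝ → ℝ} (h : tsupport φ ⊆ Ioo a b) {x : ℝ}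
    (hx : x ∉ Ioo a b) : φ x = 0 :=
  image_eq_zero_of_notMem_tsupport fun hx' => hx (h hx')

theorem hasWeakDerivOn_deriv {a b : ℝ} (hab : a ≤ b) {u : ℝ → ℝ}
    (hu : AbsolutelyContinuousOnInterval u a b) : HasWeakDerivOn a b u (deriv u) := by
  intro φ hφ _ hs
  have hφ' : AbsolutelyContinuousOnInterval φ a b :=
    (hφ.of_le (by norm_num)).contDiffOn.absolutelyContinuousOnInterval
  have h := hu.integral_mul_deriv_eq_deriv_mul hφ'
  rw [eq_zero_of_tsupport_subset_Ioo hs (x := a) (by simp),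
    eq_zero_of_tsupport_subset_Ioo hs (x := b) (by simp),
    intervalIntegral.integral_of_le hab, intervalIntegral.integral_of_le hab,
    integral_Ioc_eq_integral_Ioo, integral_Ioc_eq_integral_Ioo] at h
  rw [h]; ring

theorem HasWeakDerivOn.ae_eq {a b : ℝ} {u g g' : ℝ → ℝ} (h : HasWeakDerivOn a b u g)
    (h' : HasWeakDerivOn a b u g') (hg : IntegrableOn g (Ioo a b))
    (hg' : IntegrableOn g' (Ioo a b)) : g =ᵐ[volume.restrict (Ioo a b)] g' := by
  have key : ∀ᵐ x ∂volume, x ∈ Ioo a b → (g - g') x = 0 := by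
    refine isOpen_Ioo.ae_eq_zero_of_integral_contDiff_smul_eq_zero
      (hg.sub hg').locallyIntegrableOn ?_
    intro φ hφ hc hs
    rw [← setIntegral_eq_integral_of_forall_compl_eq_zero (s := Ioo a b)]
    · obtain ⟨C, hC⟩ := hφ.continuous.bounded_above_of_compact_support hc
      have i1 := hg.mul_bdd (c := C) hφ.continuous.aestronglyMeasurable.restrict
        (Filter.Eventually.of_forall hC)
      have i2 := hg'.mul_bdd (c := C) hφ.continuous.aestronglyMeasurable.restrict
        (Filter.Eventually.of_forall hC)
      have e : ∀ x, φ x • (g - g') x = g x * φ x - g' x * φ x := fun x => by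
        simp only [Pi.sub_apply, smul_eq_mul]; ring
      simp only [e]
      rw [integral_sub i1 i2]
      have := h φ hφ hc hs
      have := h' φ hφ hc hs
      linarith
    · intro x hx
      rw [eq_zero_of_tsupport_subset_Ioo hs hx, zero_smul]
  rw [Filter.EventuallyEq, ae_restrict_iff' measurableSet_Ioo]
  filter_upwards [key] with x hx hx'
  exact sub_eq_zero.1 (hx hx')

/-- The primitive from `a` vanishes to the left of the support of `χ`, and to the right because the
total integral is zero. -/
theorem exists_contDiff_primitive {a b : ℝ} {χ : ℝ → ℝ} (hχ : ContDiff ℝ ∞ χ)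
    (hc : HasCompactSupport χ) (hs : tsupport χ ⊆ Ioo a b) (h0 : ∫ x, χ x = 0) :
    ∃ Φ : ℝ → ℝ, ContDiff ℝ ∞ Φ ∧ HasCompactSupport Φ ∧ tsupport Φ ⊆ Ioo a b ∧ deriv Φ = χ := by
  -- A closed interval strictly inside `(a, b)` keeps the closed support of the primitive inside as
  -- well.
  obtain ⟨a', b', ha, hb, hsub⟩ : ∃ a' b', a < a' ∧ b' < b ∧ tsupport χ ⊆ Icc a' b' := by
    rcases (tsupport χ).eq_empty_or_nonempty with he | hne
    · exact ⟨a + 1, b - 1, by linarith, by linarith, by simp [he]⟩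
    · exact ⟨_, _, (hs (hc.sInf_mem hne)).1, (hs (hc.sSup_mem hne)).2, fun x hx =>
        ⟨csInf_le hc.bddBelow hx, le_csSup hc.bddAbove hx⟩⟩
  have hz : ∀ x, x ∉ Icc a' b' → χ x = 0 := fun x hx =>
    image_eq_zero_of_notMem_tsupport fun hx' => hx (hsub hx')
  let Φ : ℝ → ℝ := fun x => ∫ t in a..x, χ t
  have hd : ∀ x, HasDerivAt Φ (χ x) x := fun x =>
    intervalIntegral.integral_hasDerivAt_right (hχ.continuous.intervalIntegrable _ _)
      (hχ.continuous.stronglyMeasurableAtFilter _ _) hχ.continuous.continuousAt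
  have hdd : deriv Φ = χ := funext fun x => (hd x).deriv
  have hzero : ∀ x, x ∉ Icc a' b' → Φ x = 0 := by
    intro x hx
    rw [mem_Icc, not_and_or, not_le, not_le] at hx
    rcases hx with hx | hx
    · have : EqOn χ (fun _ => 0) (uIcc a x) := fun t ht =>
        hz t fun ht' => absurd ht'.1 (not_le.2 (lt_of_le_of_lt ht.2 (max_lt ha hx)))
      simp only [Φ]
      rw [intervalIntegral.integral_congr this]; simp
    · simp only [Φ]
      rw [intervalIntegral.integral_eq_integral_of_support_subset, h0]
      intro t ht
      have : t ∈ Icc a' b' := by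
        by_contra h
        exact ht (hz t h)
      exact ⟨ha.trans_le this.1, this.2.trans hx.le⟩
  have hts : tsupport Φ ⊆ Icc a' b' := by
    refine closure_minimal ?_ isClosed_Icc
    intro t ht
    by_contra h
    exact ht (hzero t h)
  refine ⟨Φ, ?_, HasCompactSupport.intro isCompact_Icc fun x hx => hzero x hx,
    hts.trans (Icc_subset_Ioo ha hb), hdd⟩
  rw [contDiff_infty_iff_deriv]
  exact ⟨fun x => (hd x).differentiableAt, hdd ▸ hχ⟩

theorem exists_contDiff_integral_eq_one {a b : ℝ} (hab : a < b) :
    ∃ η : ℝ → ℝ, ContDiff ℝ ∞ η ∧ HasCompactSupport η ∧ tsupport η ⊆ Ioo a b ∧ ∫ x, η x = 1 := by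
  let f : ContDiffBump ((a + b) / 2) :=
    ⟨(b - a) / 8, (b - a) / 4, by linarith, by linarith⟩
  refine ⟨f.normed volume, f.contDiff_normed, f.hasCompactSupport_normed, ?_, f.integral_normed⟩
  rw [f.tsupport_normed_eq, Real.closedBall_eq_Icc]
  exact Icc_subset_Ioo (by simp only [f]; linarith) (by simp only [f]; linarith)

/-- Du Bois-Reymond: with `∫ η = 1`, the function `ψ - (∫ ψ) η` has integral zero, so it is the
derivative of a test function and is orthogonal to `v`. Hence `∫ (v - c) ψ = 0` for every `ψ`, with
`c = ∫ v η`. -/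
theorem HasWeakDerivOn.eq_const_of_zero {a b : ℝ} (hab : a < b) {v : ℝ → ℝ}
    (hv : ContinuousOn v (Icc a b)) (h : HasWeakDerivOn a b v 0) :
    ∃ c, ∀ x ∈ Icc a b, v x = c := by
  obtain ⟨η, hη, hηc, hηs, hη1⟩ := exists_contDiff_integral_eq_one hab
  have hvi : IntegrableOn v (Ioo a b) := hv.integrableOn_Icc.mono_set Ioo_subset_Icc_self
  have hmul : ∀ ψ : ℝ → ℝ, ContDiff ℝ ∞ ψ → HasCompactSupport ψ →
      IntegrableOn (fun x => v x * ψ x) (Ioo a b) := fun ψ hψ hψc => by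
    obtain ⟨C, hC⟩ := hψ.continuous.bounded_above_of_compact_support hψc
    exact hvi.mul_bdd (c := C) hψ.continuous.aestronglyMeasurable.restrict
      (Filter.Eventually.of_forall hC)
  set c := ∫ x in Ioo a b, v x * η x
  refine ⟨c, ?_⟩
  have key : ∀ᵐ x ∂volume, x ∈ Ioo a b → v x - c = 0 := by
    refine isOpen_Ioo.ae_eq_zero_of_integral_contDiff_smul_eq_zero
      (f := fun x => v x - c)
      (hvi.sub (integrableOn_const (by simp))).locallyIntegrableOn ?_
    intro ψ hψ hψc hψs
    have hψi : Integrable ψ := hψ.continuous.integrable_of_hasCompactSupport hψc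
    have hηi : Integrable η := hη.continuous.integrable_of_hasCompactSupport hηc
    set m := ∫ x, ψ x
    obtain ⟨Φ, hΦ, hΦc, hΦs, hΦd⟩ := exists_contDiff_primitive (a := a) (b := b)
      (χ := fun x => ψ x - m * η x) (hψ.sub (contDiff_const.mul hη))
      (hψc.sub hηc.mul_left)
      ((tsupport_sub _ _).trans (union_subset hψs ((tsupport_mul_subset_right).trans hηs)))
      (by rw [integral_sub hψi (hηi.const_mul m), integral_const_mul, hη1]; simp [m])
    have h1 := h Φ hΦ hΦc hΦs
    simp only [hΦd, Pi.zero_apply, zero_mul, integral_zero, neg_zero] at h1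
    have e1 : ∀ x, v x * (ψ x - m * η x) = v x * ψ x - m * (v x * η x) := fun x => by ring
    simp only [e1] at h1
    rw [integral_sub (hmul ψ hψ hψc) ((hmul η hη hηc).const_mul m), integral_const_mul] at h1
    rw [← setIntegral_eq_integral_of_forall_compl_eq_zero (s := Ioo a b)]
    · have e2 : ∀ x, ψ x • (v x - c) = v x * ψ x - c * ψ x := fun x => by
        simp only [smul_eq_mul]; ring
      simp only [e2]
      rw [integral_sub (hmul ψ hψ hψc) (hψi.integrableOn.const_mul c), integral_const_mul,
        setIntegral_eq_integral_of_forall_compl_eq_zero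
          fun x hx => eq_zero_of_tsupport_subset_Ioo hψs hx]
      change _ - m * c = 0 at h1
      change _ - c * m = 0
      linarith
    · intro x hx
      rw [eq_zero_of_tsupport_subset_Ioo hψs hx, zero_smul]
  refine Measure.eqOn_Icc_of_ae_eq (μ := volume) hab.ne ?_ hv continuousOn_const
  rw [Filter.EventuallyEq, ← restrict_Ioo_eq_restrict_Icc, ae_restrict_iff' measurableSet_Ioo]
  filter_upwards [key] with x hx hx'
  exact sub_eq_zero.1 (hx hx')

theorem MeasureTheory.MemLp.integrableOn_Ioo {a b : ℝ} {g : ℝ → ℝ}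
    (hg : MemLp g 2 (volume.restrict (Ioo a b))) : IntegrableOn g (Ioo a b) :=
  hg.integrable (by norm_num)

theorem MeasureTheory.IntegrableOn.intervalIntegrable_of_Ioo {a b : ℝ} (hab : a ≤ b) {g : ℝ → ℝ}
    (hg : IntegrableOn g (Ioo a b)) : IntervalIntegrable g volume a b := by
  rwa [intervalIntegrable_iff_integrableOn_Ioo_of_le hab]

theorem absolutelyContinuousOnInterval_const {a b c : ℝ} :
    AbsolutelyContinuousOnInterval (fun _ : ℝ => c) a b :=
  (LipschitzWith.const c).lipschitzOnWith.absolutelyContinuousOnInterval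

/-- The difference of `u` and a primitive of its weak derivative has weak derivative zero, so it is
constant. This replaces weak derivatives by pointwise `deriv` in what follows. -/
theorem memSobolevH1_iff {a b : ℝ} (hab : a < b) {u : ℝ → ℝ} (hu : ContinuousOn u (Icc a b)) :
    MemSobolevH1 a b u ↔
      AbsolutelyContinuousOnInterval u a b ∧ MemLp (deriv u) 2 (volume.restrict (Ioo a b)) := by
  constructor
  · rintro ⟨-, g, hg, hug⟩
    have hgi := hg.integrableOn_Ioo
    have hgI := hgi.intervalIntegrable_of_Ioo hab.le
    let w : ℝ → ℝ := fun x => ∫ t in a..x, g t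
    have hw : AbsolutelyContinuousOnInterval w a b :=
      hgI.absolutelyContinuousOnInterval_intervalIntegral (by simp)
    have hwg : deriv w =ᵐ[volume.restrict (Ioo a b)] g := by
      rw [Filter.EventuallyEq, ae_restrict_iff' measurableSet_Ioo]
      filter_upwards [hgI.ae_hasDerivAt_integral] with x hx hx'
      exact (hx (Icc_subset_uIcc (Ioo_subset_Icc_self hx')) a (by simp)).deriv
    have hwc : ContinuousOn w (Icc a b) := uIcc_of_le hab.le ▸ hw.continuousOn
    obtain ⟨c, hc⟩ := HasWeakDerivOn.eq_const_of_zero hab (hu.sub hwc) (by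
      intro φ hφ hφc hφs
      have h1 := hug φ hφ hφc hφs
      have h2 := hasWeakDerivOn_deriv hab.le hw φ hφ hφc hφs
      have h3 : ∫ x in Ioo a b, deriv w x * φ x = ∫ x in Ioo a b, g x * φ x :=
        integral_congr_ae (by filter_upwards [hwg] with x hx; rw [hx])
      have hφd : Continuous (deriv φ) := hφ.continuous_deriv (by norm_num)
      have i : ∀ f : ℝ → ℝ, ContinuousOn f (Icc a b) →
          IntegrableOn (fun x => f x * deriv φ x) (Ioo a b) := fun f hf =>
        (hf.mul hφd.continuousOn).integrableOn_Icc.mono_set Ioo_subset_Icc_self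
      simp only [Pi.sub_apply, sub_mul, Pi.zero_apply, zero_mul, integral_zero, neg_zero]
      rw [integral_sub (i u hu) (i w hwc)]
      linarith)
    have hac : AbsolutelyContinuousOnInterval (fun x => c + w x) a b :=
      absolutelyContinuousOnInterval_const.add hw
    have heq : EqOn u (fun x => c + w x) (Icc a b) := fun x hx => by
      have := hc x hx
      simp only [Pi.sub_apply] at this
      simp only; linarith
    have hac' : AbsolutelyContinuousOnInterval u a b := by
      rw [absolutelyContinuousOnInterval_iff] at hac ⊢
      intro ε hε
      obtain ⟨δ, hδ, H⟩ := hac ε hε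
      refine ⟨δ, hδ, fun E hE hE' => ?_⟩
      refine lt_of_eq_of_lt (Finset.sum_congr rfl fun i hi => ?_) (H E hE hE')
      have := hE.1 i hi
      rw [uIcc_of_le hab.le] at this
      rw [heq this.1, heq this.2]
    refine ⟨hac', (memLp_congr_ae ?_).1 hg⟩
    filter_upwards [hwg, self_mem_ae_restrict measurableSet_Ioo] with x hx hx'
    rw [← hx]
    have : u =ᶠ[nhds x] fun x => c + w x := by
      filter_upwards [Ioo_mem_nhds hx'.1 hx'.2] with y hy
      exact heq (Ioo_subset_Icc_self hy)
    rw [this.deriv_eq, deriv_const_add]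
  · rintro ⟨h, h'⟩
    refine ⟨?_, deriv u, h', hasWeakDerivOn_deriv hab.le h⟩
    obtain ⟨C, hC⟩ := isCompact_Icc.exists_bound_of_continuousOn hu
    refine MemLp.of_bound ((hu.mono Ioo_subset_Icc_self).aestronglyMeasurable measurableSet_Ioo) C ?_
    filter_upwards [self_mem_ae_restrict measurableSet_Ioo] with x hx
    exact hC x (Ioo_subset_Icc_self hx)

theorem weakDerivOn_ae_eq_deriv {a b : ℝ} (hab : a < b) {u : ℝ → ℝ}
    (hu : ContinuousOn u (Icc a b)) (h : MemSobolevH1 a b u) :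
    weakDerivOn a b u =ᵐ[volume.restrict (Ioo a b)] deriv u := by
  obtain ⟨hac, hd⟩ := (memSobolevH1_iff hab hu).1 h
  rw [weakDerivOn, dif_pos h]
  exact h.2.choose_spec.2.ae_eq (hasWeakDerivOn_deriv hab.le hac)
    h.2.choose_spec.1.integrableOn_Ioo hd.integrableOn_Ioo

theorem AbsolutelyContinuousOnInterval.of_abs_sub_le {a b : ℝ} (hab : a ≤ b) {u v : ℝ → ℝ}
    (hu : AbsolutelyContinuousOnInterval u a b)
    (h : ∀ s ∈ Icc a b, ∀ t ∈ Icc a b, |v s - v t| ≤ |u s - u t|) :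
    AbsolutelyContinuousOnInterval v a b := by
  rw [absolutelyContinuousOnInterval_iff] at hu ⊢
  intro ε hε
  obtain ⟨δ, hδ, H⟩ := hu ε hε
  refine ⟨δ, hδ, fun E hE hE' => ?_⟩
  refine lt_of_le_of_lt (Finset.sum_le_sum fun i hi => ?_) (H E hE hE')
  have := hE.1 i hi
  rw [uIcc_of_le hab] at this
  exact h _ this.1 _ this.2

theorem AbsolutelyContinuousOnInterval.ae_differentiableAt_Ioo {a b : ℝ} {u : ℝ → ℝ}
    (hu : AbsolutelyContinuousOnInterval u a b) :
    ∀ᵐ x ∂volume.restrict (Ioo a b), DifferentiableAt ℝ u x := by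
  rw [ae_restrict_iff' measurableSet_Ioo]
  filter_upwards [hu.ae_differentiableAt] with x hx hx'
  exact hx (Icc_subset_uIcc (Ioo_subset_Icc_self hx'))

/-- The inequality holds for difference quotients and passes to the limit wherever both functions
are differentiable. -/
theorem AbsolutelyContinuousOnInterval.abs_deriv_le_of_abs_sub_le {a b : ℝ} {u v : ℝ → ℝ}
    (hu : AbsolutelyContinuousOnInterval u a b) (hv : AbsolutelyContinuousOnInterval v a b)
    (h : ∀ s ∈ Icc a b, ∀ t ∈ Icc a b, |v s - v t| ≤ |u s - u t|) :
    ∀ᵐ x ∂volume.restrict (Ioo a b), |deriv v x| ≤ |deriv u x| := by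
  filter_upwards [hu.ae_differentiableAt_Ioo, hv.ae_differentiableAt_Ioo,
    self_mem_ae_restrict measurableSet_Ioo] with x hxu hxv hx
  have tu := (hasDerivAt_iff_tendsto_slope.1 hxu.hasDerivAt).abs
  have tv := (hasDerivAt_iff_tendsto_slope.1 hxv.hasDerivAt).abs
  refine le_of_tendsto_of_tendsto tv tu ?_
  filter_upwards [mem_nhdsWithin_of_mem_nhds (Ioo_mem_nhds hx.1 hx.2)] with y hy
  simp only [slope_def_field, abs_div]
  exact div_le_div_of_nonneg_right (h y (Ioo_subset_Icc_self hy) x (Ioo_subset_Icc_self hx))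
    (abs_nonneg _)

/-! ### Points, paths and distance on a metric graph -/

namespace MetricGraph

variable {V : Type*} {E : Type*} (G : MetricGraph V E)

/-- The point of the metric graph that corresponds to a vertex. -/
def vertex (v : V) : G.Point := Quot.mk _ (Sum.inl v)

theorem edge_left (e : E) :
    G.edge e ⟨0, left_mem_Icc.2 (G.len_pos e).le⟩ = G.vertex (G.src e) :=
  Quot.sound (Glue.left e)

theorem edge_right (e : E) :
    G.edge e ⟨G.len e, right_mem_Icc.2 (G.len_pos e).le⟩ = G.vertex (G.tgt e) :=
  Quot.sound (Glue.right e)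

theorem continuous_edge (e : E) : Continuous (G.edge e) := by
  rw [continuous_iff_coinduced_le]
  exact le_iSup (fun e => TopologicalSpace.coinduced (G.edge e) inferInstance) e

theorem continuous_iff_edge {X : Type*} [TopologicalSpace X] {f : G.Point → X} :
    Continuous f ↔ ∀ e, Continuous fun t => f (G.edge e t) := by
  constructor
  · exact fun h e => h.comp (G.continuous_edge e)
  · intro h
    refine continuous_iSup_dom.2 fun e => ?_
    rw [continuous_coinduced_dom]
    exact h e

/-- Being an endpoint of some edge is invariant under the relation generated by adjacency, and it
holds for at least one vertex. Consequently every point lies on an edge. -/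
theorem exists_src_or_tgt_eq [Nonempty E] (v : V) : ∃ e, G.src e = v ∨ G.tgt e = v := by
  have key : ∀ a b, Relation.EqvGen (fun a b => ∃ e, G.src e = a ∧ G.tgt e = b) a b →
      ((∃ e, G.src e = a ∨ G.tgt e = a) ↔ ∃ e, G.src e = b ∨ G.tgt e = b) := by
    intro a b h
    induction h with
    | rel a b h =>
      obtain ⟨e, h1, h2⟩ := h
      exact iff_of_true ⟨e, Or.inl h1⟩ ⟨e, Or.inr h2⟩
    | refl a => rfl
    | symm a b _ ih => exact ih.symm
    | trans a b c _ _ ih1 ih2 => exact ih1.trans ih2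
  obtain ⟨e⟩ := ‹Nonempty E›
  exact (key _ v (G.connected (G.src e) v)).1 ⟨e, Or.inl rfl⟩

theorem exists_eq_edge [Nonempty E] (x : G.Point) : ∃ e t, x = G.edge e t := by
  induction x using Quot.ind with
  | mk x =>
    rcases x with v | ⟨e, t⟩
    · obtain ⟨e, rfl | rfl⟩ := G.exists_src_or_tgt_eq v
      · exact ⟨e, _, (G.edge_left e).symm⟩
      · exact ⟨e, _, (G.edge_right e).symm⟩
    · exact ⟨e, t, rfl⟩

variable {G}

theorem PathOfLength.nonneg {x y : G.Point} {s : ℝ} (h : G.PathOfLength x y s) : 0 ≤ s := by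
  induction h with
  | refl x => exact le_rfl
  | cons e t t' y s _ ih => positivity

theorem PathOfLength.trans {x y z : G.Point} {s s' : ℝ} (h : G.PathOfLength x y s)
    (h' : G.PathOfLength y z s') : G.PathOfLength x z (s + s') := by
  induction h with
  | refl x => simpa using h'
  | cons e t t' y s _ ih => rw [add_assoc]; exact .cons e t t' z _ (ih h')

theorem PathOfLength.edge (e : E) (t t' : Icc (0 : ℝ) (G.len e)) :
    G.PathOfLength (G.edge e t) (G.edge e t') |(t : ℝ) - t'| := by
  simpa using PathOfLength.cons e t t' _ 0 (.refl _)

theorem PathOfLength.symm {x y : G.Point} {s : ℝ} (h : G.PathOfLength x y s) :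
    G.PathOfLength y x s := by
  induction h with
  | refl x => exact .refl x
  | cons e t t' y s _ ih =>
    rw [add_comm, abs_sub_comm]
    exact ih.trans (.edge e t' t)

variable (G)

theorem exists_pathOfLength [Nonempty E] (x y : G.Point) : ∃ s, G.PathOfLength x y s := by
  have key : ∀ a b, Relation.EqvGen (fun a b => ∃ e, G.src e = a ∧ G.tgt e = b) a b →
      ∃ s, G.PathOfLength (G.vertex a) (G.vertex b) s := by
    intro a b h
    induction h with
    | rel a b h =>
      obtain ⟨e, rfl, rfl⟩ := h
      rw [← edge_left, ← edge_right]
      exact ⟨_, .edge e _ _⟩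
    | refl a => exact ⟨0, .refl _⟩
    | symm a b _ ih => exact ih.imp fun _ => PathOfLength.symm
    | trans a b c _ _ ih1 ih2 =>
      obtain ⟨s, hs⟩ := ih1
      obtain ⟨s', hs'⟩ := ih2
      exact ⟨_, hs.trans hs'⟩
  obtain ⟨e, t, rfl⟩ := G.exists_eq_edge x
  obtain ⟨e', t', rfl⟩ := G.exists_eq_edge y
  obtain ⟨s, hs⟩ := key _ _ (G.connected (G.src e) (G.src e'))
  rw [← edge_left, ← edge_left] at hs
  exact ⟨_, (PathOfLength.edge e t _).trans (hs.trans (.edge e' _ t'))⟩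

theorem bddBelow_pathOfLength (x y : G.Point) : BddBelow {s | G.PathOfLength x y s} :=
  ⟨0, fun _ h => PathOfLength.nonneg h⟩

theorem pathDist_nonneg (x y : G.Point) : 0 ≤ G.pathDist x y :=
  Real.sInf_nonneg fun _ h => PathOfLength.nonneg h

theorem pathDist_self (x : G.Point) : G.pathDist x x = 0 :=
  le_antisymm (csInf_le (G.bddBelow_pathOfLength x x) (.refl x)) (G.pathDist_nonneg x x)

theorem pathDist_edge_sub_le [Nonempty E] (y : G.Point) (e : E) (t t' : Icc (0 : ℝ) (G.len e)) :
    G.pathDist (G.edge e t) y - G.pathDist (G.edge e t') y ≤ |(t : ℝ) - t'| := by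
  have : G.pathDist (G.edge e t) y - |(t : ℝ) - t'| ≤ G.pathDist (G.edge e t') y := by
    refine le_csInf (G.exists_pathOfLength _ _) fun s hs => ?_
    have := csInf_le (G.bddBelow_pathOfLength (G.edge e t) y) (PathOfLength.cons e t t' y s hs)
    change G.pathDist (G.edge e t) y ≤ _ at this
    linarith
  linarith

theorem abs_pathDist_edge_sub_le [Nonempty E] (y : G.Point) (e : E)
    (t t' : Icc (0 : ℝ) (G.len e)) :
    |G.pathDist (G.edge e t) y - G.pathDist (G.edge e t') y| ≤ |(t : ℝ) - t'| := by
  rw [abs_le]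
  have h1 := G.pathDist_edge_sub_le y e t t'
  have h2 := G.pathDist_edge_sub_le y e t' t
  rw [abs_sub_comm] at h2
  constructor <;> linarith

theorem restrictEdge_of_mem (f : G.Point → ℝ) (e : E) {s : ℝ} (hs : s ∈ Icc 0 (G.len e)) :
    G.restrictEdge f e s = f (G.edge e ⟨s, hs⟩) := by
  rw [restrictEdge, projIcc_of_mem]

theorem continuous_restrictEdge {f : G.Point → ℝ} (hf : Continuous f) (e : E) :
    Continuous (G.restrictEdge f e) :=
  hf.comp ((G.continuous_edge e).comp continuous_projIcc)

theorem mem_H1_iff {f : G.Point → ℝ} :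
    f ∈ G.H1 ↔ Continuous f ∧ ∀ e,
      AbsolutelyContinuousOnInterval (G.restrictEdge f e) 0 (G.len e) ∧
      MemLp (deriv (G.restrictEdge f e)) 2 (volume.restrict (Ioo 0 (G.len e))) :=
  and_congr_right fun hf => forall_congr' fun e =>
    memSobolevH1_iff (G.len_pos e) (G.continuous_restrictEdge hf e).continuousOn

/-! ### The energy as an inner product of gradients -/

variable {G}

theorem absolutelyContinuous_of_mem_H1 {f : G.Point → ℝ} (hf : f ∈ G.H1) (e : E) :
    AbsolutelyContinuousOnInterval (G.restrictEdge f e) 0 (G.len e) :=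
  ((G.mem_H1_iff.1 hf).2 e).1

theorem memLp_deriv_of_mem_H1 {f : G.Point → ℝ} (hf : f ∈ G.H1) (e : E) :
    MemLp (deriv (G.restrictEdge f e)) 2 (volume.restrict (Ioo 0 (G.len e))) :=
  ((G.mem_H1_iff.1 hf).2 e).2

theorem deriv_restrictEdge_add {f g : G.Point → ℝ} (hf : f ∈ G.H1) (hg : g ∈ G.H1) (e : E) :
    deriv (G.restrictEdge (f + g) e) =ᵐ[volume.restrict (Ioo 0 (G.len e))]
      deriv (G.restrictEdge f e) + deriv (G.restrictEdge g e) := by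
  filter_upwards [(absolutelyContinuous_of_mem_H1 hf e).ae_differentiableAt_Ioo,
    (absolutelyContinuous_of_mem_H1 hg e).ae_differentiableAt_Ioo] with x hx hx'
  exact deriv_add hx hx'

theorem deriv_restrictEdge_smul (c : ℝ) (f : G.Point → ℝ) (e : E) :
    deriv (G.restrictEdge (c • f) e) = c • deriv (G.restrictEdge f e) := by
  ext x
  exact deriv_const_smul_field c (G.restrictEdge f e)

theorem const_mem_H1 (c : ℝ) : (fun _ => c) ∈ G.H1 := by
  refine G.mem_H1_iff.2 ⟨continuous_const, fun e => ⟨absolutelyContinuousOnInterval_const, ?_⟩⟩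
  have : deriv (G.restrictEdge (fun _ => c) e) = 0 := by
    ext x
    exact deriv_const x c
  rw [this]
  exact MemLp.zero

variable (G)

/-- The Sobolev space `H¹(G)` as a vector space. -/
def h1 : Submodule ℝ (G.Point → ℝ) where
  carrier := G.H1
  zero_mem' := const_mem_H1 0
  add_mem' {f g} hf hg := by
    refine G.mem_H1_iff.2 ⟨hf.1.add hg.1, fun e => ⟨?_, ?_⟩⟩
    · exact (absolutelyContinuous_of_mem_H1 hf e).add (absolutelyContinuous_of_mem_H1 hg e)
    · exact (memLp_congr_ae (deriv_restrictEdge_add hf hg e)).2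
        ((memLp_deriv_of_mem_H1 hf e).add (memLp_deriv_of_mem_H1 hg e))
  smul_mem' c f hf := by
    refine G.mem_H1_iff.2 ⟨hf.1.const_smul c, fun e => ⟨?_, ?_⟩⟩
    · exact (absolutelyContinuous_of_mem_H1 hf e).const_smul c
    · rw [deriv_restrictEdge_smul]
      exact (memLp_deriv_of_mem_H1 hf e).const_smul c

/-- The space of square integrable vector fields on the graph, with respect to arc length. -/
abbrev VectorField : Type _ := PiLp 2 fun e => Lp ℝ 2 (volume.restrict (Ioo 0 (G.len e)))

/-- The derivative along the edges of a function in `H¹(G)`. -/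
noncomputable def grad : G.h1 →ₗ[ℝ] G.VectorField where
  toFun f := WithLp.toLp 2 fun e => (memLp_deriv_of_mem_H1 f.2 e).toLp _
  map_add' f g := by
    refine PiLp.ext fun e => ?_
    simp only [PiLp.add_apply]
    rw [← MemLp.toLp_add]
    exact MemLp.toLp_congr _ _ (deriv_restrictEdge_add f.2 g.2 e)
  map_smul' c f := by
    refine PiLp.ext fun e => ?_
    simp only [RingHom.id_apply, PiLp.smul_apply]
    rw [← MemLp.toLp_const_smul]
    exact MemLp.toLp_congr _ _
      (Filter.EventuallyEq.of_eq (deriv_restrictEdge_smul c (f : G.Point → ℝ) e))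

variable {G}

theorem coeFn_grad (f : G.h1) (e : E) :
    (G.grad f e : ℝ → ℝ) =ᵐ[volume.restrict (Ioo 0 (G.len e))] deriv (G.restrictEdge f e) :=
  (memLp_deriv_of_mem_H1 f.2 e).coeFn_toLp

theorem energy_eq_inner [Fintype E] (f g : G.h1) :
    G.energy f g = inner ℝ (G.grad f) (G.grad g) := by
  rw [PiLp.inner_apply, energy]
  refine Finset.sum_congr rfl fun e _ => ?_
  rw [L2.inner_def]
  refine integral_congr_ae ?_
  filter_upwards [coeFn_grad f e, coeFn_grad g e,
    weakDerivOn_ae_eq_deriv (G.len_pos e) (G.continuous_restrictEdge f.2.1 e).continuousOn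
      (f.2.2 e),
    weakDerivOn_ae_eq_deriv (G.len_pos e) (G.continuous_restrictEdge g.2.1 e).continuousOn
      (g.2.2 e)] with x h1 h2 h3 h4
  rw [h1, h2, h3, h4, real_inner_eq_re_inner]
  simp [mul_comm]

theorem integral_grad (f : G.h1) (e : E) {t t' : Icc (0 : ℝ) (G.len e)} (h : t ≤ t') :
    ∫ x in Ioo (t : ℝ) t', G.grad f e x ∂(volume.restrict (Ioo 0 (G.len e))) =
      (f : G.Point → ℝ) (G.edge e t') - (f : G.Point → ℝ) (G.edge e t) := by
  have hac := (absolutelyContinuous_of_mem_H1 f.2 e).mono (c := t) (d := t')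
    (uIcc_subset_uIcc (Icc_subset_uIcc t.2) (Icc_subset_uIcc t'.2))
  have hsub : Ioo (t : ℝ) t' ⊆ Ioo 0 (G.len e) := Ioo_subset_Ioo t.2.1 t'.2.2
  rw [integral_congr_ae (ae_restrict_of_ae (coeFn_grad f e)),
    Measure.restrict_restrict measurableSet_Ioo, inter_eq_left.2 hsub,
    ← integral_Ioc_eq_integral_Ioo, ← intervalIntegral.integral_of_le h,
    hac.integral_deriv_eq_sub, restrictEdge_of_mem _ _ _ t.2, restrictEdge_of_mem _ _ _ t'.2]

/-- The field is the indicator of the segment from `t` to `t'`: pairing with it is the fundamental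
theorem of calculus, and its squared norm is the length of the segment. -/
theorem exists_vectorField_edge_of_le [Fintype E] (e : E) {t t' : Icc (0 : ℝ) (G.len e)}
    (h : t ≤ t') : ∃ v : G.VectorField, ‖v‖ ^ 2 ≤ |(t : ℝ) - t'| ∧ ∀ f : G.h1,
      (f : G.Point → ℝ) (G.edge e t') - (f : G.Point → ℝ) (G.edge e t) =
        inner ℝ v (G.grad f) := by
  classical
  set w : Lp ℝ 2 (volume.restrict (Ioo 0 (G.len e))) :=
    indicatorConstLp 2 (measurableSet_Ioo (a := (t : ℝ)) (b := t')) (measure_ne_top _ _) 1 with hw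
  refine ⟨PiLp.single 2 e w, ?_, fun f => ?_⟩
  · rw [PiLp.norm_single, hw, norm_indicatorConstLp (by norm_num) (by norm_num)]
    have hvol : (volume.restrict (Ioo 0 (G.len e))).real (Ioo (t : ℝ) t') ≤ |(t : ℝ) - t'| := by
      refine (ENNReal.toReal_mono (by simp) (Measure.restrict_apply_le _ _)).trans ?_
      rw [Real.volume_Ioo, abs_sub_comm, ENNReal.toReal_ofReal (sub_nonneg.2 h)]
      exact le_abs_self _
    rw [norm_one, one_mul, ← Real.rpow_natCast, ← Real.rpow_mul measureReal_nonneg]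
    simpa using hvol
  · rw [← integral_grad f e h, ← L2.inner_indicatorConstLp_one measurableSet_Ioo
      (measure_ne_top _ _), PiLp.inner_apply, Finset.sum_eq_single e]
    · simp [hw]
    · intro e' _ he'
      simp [PiLp.single_eq_of_ne 2 he']
    · simp

theorem exists_vectorField_edge [Fintype E] (e : E) (t t' : Icc (0 : ℝ) (G.len e)) :
    ∃ v : G.VectorField, ‖v‖ ^ 2 ≤ |(t : ℝ) - t'| ∧ ∀ f : G.h1,
      (f : G.Point → ℝ) (G.edge e t) - (f : G.Point → ℝ) (G.edge e t') =
        inner ℝ v (G.grad f) := by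
  rcases le_total t t' with h | h
  · obtain ⟨v, hv, hv'⟩ := exists_vectorField_edge_of_le e h
    refine ⟨-v, by rwa [norm_neg], fun f => ?_⟩
    rw [inner_neg_left, ← hv']
    ring
  · obtain ⟨v, hv, hv'⟩ := exists_vectorField_edge_of_le e h
    exact ⟨v, by rwa [abs_sub_comm], hv'⟩

/-- The fields of the segments of a path add up. No norm bound is kept: a path may run over a
segment repeatedly, and only boundedness of the functional matters here. -/
theorem exists_vectorField [Fintype E] [Nonempty E] (x y : G.Point) :
    ∃ v : G.VectorField, ∀ f : G.h1,
      (f : G.Point → ℝ) x - (f : G.Point → ℝ) y = inner ℝ v (G.grad f) := by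
  obtain ⟨s, hs⟩ := G.exists_pathOfLength x y
  induction hs with
  | refl x => exact ⟨0, fun f => by simp⟩
  | cons e t t' y s _ ih =>
    obtain ⟨v, hv⟩ := ih
    obtain ⟨w, -, hw⟩ := exists_vectorField_edge e t t'
    refine ⟨w + v, fun f => ?_⟩
    rw [inner_add_left, ← hv, ← hw]
    ring

theorem sq_sub_edge_le [Fintype E] (f : G.h1) (e : E) (t t' : Icc (0 : ℝ) (G.len e)) :
    ((f : G.Point → ℝ) (G.edge e t) - (f : G.Point → ℝ) (G.edge e t')) ^ 2 ≤
      |(t : ℝ) - t'| * G.energy f f := by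
  obtain ⟨v, hv, hv'⟩ := exists_vectorField_edge e t t'
  rw [hv', energy_eq_inner, real_inner_self_eq_norm_sq, ← sq_abs]
  calc |inner ℝ v (G.grad f)| ^ 2 ≤ (‖v‖ * ‖G.grad f‖) ^ 2 := by
        gcongr; exact abs_real_inner_le_norm _ _
    _ = ‖v‖ ^ 2 * ‖G.grad f‖ ^ 2 := by ring
    _ ≤ _ := by gcongr

end MetricGraph

/-! ### Energy comparison and closedness of the space of gradients -/

namespace MetricGraph

variable {V : Type*} {E : Type*} {G : MetricGraph V E}

theorem energy_self_eq_sum [Fintype E] {f : G.Point → ℝ} (hf : f ∈ G.H1) :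
    G.energy f f = ∑ e, ∫ s in Ioo 0 (G.len e), deriv (G.restrictEdge f e) s ^ 2 := by
  refine Finset.sum_congr rfl fun e _ => integral_congr_ae ?_
  filter_upwards [weakDerivOn_ae_eq_deriv (G.len_pos e)
    (G.continuous_restrictEdge hf.1 e).continuousOn (hf.2 e)] with x hx
  rw [hx, sq]

/-- The comparison functions `u e` need not match at the vertices, so this covers contractions of
`H¹` functions, Lipschitz functions (`u e = id`) and edgewise primitives alike. -/
theorem mem_H1_of_abs_sub_le {g : G.Point → ℝ} {u : E → ℝ → ℝ}
    (hu : ∀ e, AbsolutelyContinuousOnInterval (u e) 0 (G.len e))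
    (hu' : ∀ e, MemLp (deriv (u e)) 2 (volume.restrict (Ioo 0 (G.len e))))
    (h : ∀ (e : E) (t t' : Icc (0 : ℝ) (G.len e)),
      |g (G.edge e t) - g (G.edge e t')| ≤ |u e t - u e t'|) : g ∈ G.H1 := by
  have hle : ∀ e, ∀ s ∈ Icc 0 (G.len e), ∀ t ∈ Icc 0 (G.len e),
      |G.restrictEdge g e s - G.restrictEdge g e t| ≤ |u e s - u e t| := fun e s hs t ht => by
    rw [restrictEdge_of_mem _ _ _ hs, restrictEdge_of_mem _ _ _ ht]
    exact h e ⟨s, hs⟩ ⟨t, ht⟩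
  have hac : ∀ e, AbsolutelyContinuousOnInterval (G.restrictEdge g e) 0 (G.len e) := fun e =>
    (hu e).of_abs_sub_le (G.len_pos e).le (hle e)
  refine G.mem_H1_iff.2 ⟨G.continuous_iff_edge.2 fun e => ?_, fun e => ⟨hac e, ?_⟩⟩
  · have hc := (hac e).continuousOn
    rw [uIcc_of_le (G.len_pos e).le, continuousOn_iff_continuous_domRestrict] at hc
    refine hc.congr fun t => ?_
    rw [domRestrict_apply, restrictEdge_of_mem]
  · exact (hu' e).mono (measurable_deriv _).aestronglyMeasurable
      ((hu e).abs_deriv_le_of_abs_sub_le (hac e) (hle e))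

theorem energy_le_of_abs_sub_le [Fintype E] {g : G.Point → ℝ} {u : E → ℝ → ℝ}
    (hu : ∀ e, AbsolutelyContinuousOnInterval (u e) 0 (G.len e))
    (hu' : ∀ e, MemLp (deriv (u e)) 2 (volume.restrict (Ioo 0 (G.len e))))
    (h : ∀ (e : E) (t t' : Icc (0 : ℝ) (G.len e)),
      |g (G.edge e t) - g (G.edge e t')| ≤ |u e t - u e t'|) :
    G.energy g g ≤ ∑ e, ∫ s in Ioo 0 (G.len e), deriv (u e) s ^ 2 := by
  have hg := mem_H1_of_abs_sub_le hu hu' h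
  rw [energy_self_eq_sum hg]
  refine Finset.sum_le_sum fun e _ => ?_
  refine integral_mono_ae (memLp_deriv_of_mem_H1 hg e).integrable_sq (hu' e).integrable_sq ?_
  filter_upwards [(hu e).abs_deriv_le_of_abs_sub_le (absolutelyContinuous_of_mem_H1 hg e)
    (fun s hs t ht => by
      rw [restrictEdge_of_mem _ _ _ hs, restrictEdge_of_mem _ _ _ ht]
      exact h e ⟨s, hs⟩ ⟨t, ht⟩)] with x hx
  exact sq_le_sq.2 hx

theorem mem_H1_of_contraction {f g : G.Point → ℝ} (hf : f ∈ G.H1)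
    (h : ∀ x y, |g x - g y| ≤ |f x - f y|) : g ∈ G.H1 :=
  mem_H1_of_abs_sub_le (absolutelyContinuous_of_mem_H1 hf) (memLp_deriv_of_mem_H1 hf)
    fun e t t' => by
      rw [restrictEdge_of_mem _ _ _ t.2, restrictEdge_of_mem _ _ _ t'.2]
      exact h _ _

theorem energy_le_of_contraction [Fintype E] {f g : G.Point → ℝ} (hf : f ∈ G.H1)
    (h : ∀ x y, |g x - g y| ≤ |f x - f y|) : G.energy g g ≤ G.energy f f := by
  rw [energy_self_eq_sum hf]
  refine energy_le_of_abs_sub_le (absolutelyContinuous_of_mem_H1 hf) (memLp_deriv_of_mem_H1 hf)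
    fun e t t' => ?_
  rw [restrictEdge_of_mem _ _ _ t.2, restrictEdge_of_mem _ _ _ t'.2]
  exact h _ _

theorem mem_H1_of_lipschitz {g : G.Point → ℝ} (h : ∀ (e : E) (t t' : Icc (0 : ℝ) (G.len e)),
    |g (G.edge e t) - g (G.edge e t')| ≤ |(t : ℝ) - t'|) : g ∈ G.H1 :=
  mem_H1_of_abs_sub_le (u := fun _ x => x)
    (fun _ => LipschitzWith.id.lipschitzOnWith.absolutelyContinuousOnInterval)
    (fun _ => by simpa using memLp_const (1 : ℝ)) h

theorem energy_le_totalLength [Fintype E] {g : G.Point → ℝ}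
    (h : ∀ (e : E) (t t' : Icc (0 : ℝ) (G.len e)),
      |g (G.edge e t) - g (G.edge e t')| ≤ |(t : ℝ) - t'|) : G.energy g g ≤ G.totalLength := by
  refine (energy_le_of_abs_sub_le (u := fun _ x => x)
    (fun _ => LipschitzWith.id.lipschitzOnWith.absolutelyContinuousOnInterval)
    (fun _ => by simpa using memLp_const (1 : ℝ)) h).trans_eq ?_
  refine Finset.sum_congr rfl fun e _ => ?_
  simp [(G.len_pos e).le]

/-- Given `p`, integrate `g` along each edge starting from the value of `p` at the initial vertex;
the condition says exactly that the result is compatible with the gluing at the terminal vertex. -/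
theorem mem_range_grad_iff {g : G.VectorField} :
    g ∈ LinearMap.range G.grad ↔ ∃ p : V → ℝ, ∀ e,
      p (G.tgt e) - p (G.src e) = ∫ x in Ioo 0 (G.len e), g e x := by
  constructor
  · rintro ⟨f, rfl⟩
    refine ⟨fun v => (f : G.Point → ℝ) (G.vertex v), fun e => ?_⟩
    have h := integral_grad f e (t := ⟨0, left_mem_Icc.2 (G.len_pos e).le⟩)
      (t' := ⟨G.len e, right_mem_Icc.2 (G.len_pos e).le⟩) (G.len_pos e).le
    rw [edge_left, edge_right, Measure.restrict_restrict measurableSet_Ioo, inter_self] at h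
    exact h.symm
  · rintro ⟨p, hp⟩
    have hI : ∀ e, IntervalIntegrable (g e) volume 0 (G.len e) := fun e =>
      (Lp.memLp (g e)).integrableOn_Ioo.intervalIntegrable_of_Ioo (G.len_pos e).le
    let f : G.Point → ℝ := Quot.lift
      (Sum.elim p fun z => p (G.src z.1) + ∫ x in (0 : ℝ)..z.2, g z.1 x) (by
        rintro _ _ (e | e)
        · simp
        · simp only [Sum.elim_inr, Sum.elim_inl]
          rw [intervalIntegral.integral_of_le (G.len_pos e).le, integral_Ioc_eq_integral_Ioo,
            ← hp e]
          ring)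
    have hf : ∀ e (t : Icc (0 : ℝ) (G.len e)),
        f (G.edge e t) = p (G.src e) + ∫ x in (0 : ℝ)..t, g e x := fun _ _ => rfl
    have hac : ∀ e, AbsolutelyContinuousOnInterval (fun t => ∫ x in (0 : ℝ)..t, g e x) 0
        (G.len e) := fun e => (hI e).absolutelyContinuousOnInterval_intervalIntegral (by simp)
    have hd : ∀ e, deriv (fun t => ∫ x in (0 : ℝ)..t, g e x)
        =ᵐ[volume.restrict (Ioo 0 (G.len e))] g e := fun e => by
      rw [Filter.EventuallyEq, ae_restrict_iff' measurableSet_Ioo]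
      filter_upwards [(hI e).ae_hasDerivAt_integral] with x hx hx'
      exact (hx (Icc_subset_uIcc (Ioo_subset_Icc_self hx')) 0 (by simp)).deriv
    have hf1 : f ∈ G.H1 := mem_H1_of_abs_sub_le hac
      (fun e => (memLp_congr_ae (hd e)).2 (Lp.memLp (g e)))
      fun e t t' => by rw [hf, hf, add_sub_add_left_eq_sub]
    refine ⟨⟨f, hf1⟩, PiLp.ext fun e => Lp.ext ?_⟩
    filter_upwards [coeFn_grad ⟨f, hf1⟩ e, hd e, self_mem_ae_restrict measurableSet_Ioo]
      with x h1 h2 hx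
    rw [h1, ← h2]
    have : G.restrictEdge f e =ᶠ[nhds x] fun t => p (G.src e) + ∫ x in (0 : ℝ)..t, g e x := by
      filter_upwards [Ioo_mem_nhds hx.1 hx.2] with y hy
      rw [restrictEdge_of_mem _ _ _ (Ioo_subset_Icc_self hy), hf]
    rw [this.deriv_eq, deriv_const_add]

/-- Being a gradient depends only on the edge integrals, which must lie in the range of the
coboundary `δ`. That is a subspace of the finite-dimensional space `E → ℝ`, and the map `T` to the
edge integrals is continuous. -/
theorem isClosed_range_grad [Fintype E] : IsClosed (LinearMap.range G.grad : Set G.VectorField) := by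
  let T : G.VectorField →L[ℝ] (E → ℝ) := ContinuousLinearMap.pi fun e =>
    (innerSL ℝ (indicatorConstLp 2 (μ := volume.restrict (Ioo 0 (G.len e)))
      (measurableSet_Ioo (a := 0) (b := G.len e)) (measure_ne_top _ _) (1 : ℝ))).comp
      (PiLp.proj 2 (fun e => Lp ℝ 2 (volume.restrict (Ioo 0 (G.len e)))) e)
  have hT : ∀ g e, T g e = ∫ x in Ioo 0 (G.len e), g e x := fun g e => by
    have h := L2.inner_indicatorConstLp_one (𝕜 := ℝ) (μ := volume.restrict (Ioo 0 (G.len e)))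
      (measurableSet_Ioo (a := 0) (b := G.len e)) (measure_ne_top _ _) (g e)
    rw [Measure.restrict_restrict measurableSet_Ioo, inter_self] at h
    exact h
  let δ : (V → ℝ) →ₗ[ℝ] (E → ℝ) :=
    LinearMap.pi fun e : E => LinearMap.proj (R := ℝ) (φ := fun _ : V => ℝ) (G.tgt e) -
      LinearMap.proj (R := ℝ) (φ := fun _ : V => ℝ) (G.src e)
  have : (LinearMap.range G.grad : Set G.VectorField) = T ⁻¹' (LinearMap.range δ : Set (E → ℝ)) := by
    ext g
    rw [SetLike.mem_coe, mem_range_grad_iff, mem_preimage, SetLike.mem_coe, LinearMap.mem_range]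
    refine exists_congr fun p => ?_
    rw [funext_iff]
    exact forall_congr' fun e => by rw [hT]; rfl
  rw [this]
  exact (Submodule.closed_of_finiteDimensional _).preimage T.continuous

/-! ### Dipole potentials and effective resistance -/

theorem energy_self_nonneg [Fintype E] (f : G.h1) : 0 ≤ G.energy f f := by
  rw [energy_eq_inner]
  exact real_inner_self_nonneg

theorem energy_sub_self [Fintype E] (f g : G.h1) :
    G.energy (f - g : G.h1) (f - g : G.h1) =
      G.energy f f - 2 * G.energy g f + G.energy g g := by
  simp only [energy_eq_inner, map_sub, inner_sub_left, inner_sub_right,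
    real_inner_comm (G.grad g) (G.grad f)]
  ring

theorem energy_sub_left [Fintype E] (f g φ : G.h1) :
    G.energy (f - g : G.h1) φ = G.energy f φ - G.energy g φ := by
  simp only [energy_eq_inner, map_sub, inner_sub_left]

/-- The orthogonal projection of the path field onto the closed space of gradients is a gradient
with the same pairings against gradients. -/
theorem exists_dipole [Fintype E] [Nonempty E] (x y : G.Point) :
    ∃ h : G.h1, ∀ φ : G.h1, G.energy h φ = (φ : G.Point → ℝ) x - (φ : G.Point → ℝ) y := by
  obtain ⟨v, hv⟩ := exists_vectorField (G := G) x y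
  have : CompleteSpace (LinearMap.range G.grad) := isClosed_range_grad.completeSpace_coe
  obtain ⟨h, hh⟩ := (LinearMap.range G.grad).starProjection_apply_mem v
  refine ⟨h, fun φ => ?_⟩
  have h0 := (LinearMap.range G.grad).starProjection_inner_eq_zero v (G.grad φ) ⟨φ, rfl⟩
  rw [energy_eq_inner, hv, hh]
  rw [inner_sub_left] at h0
  linarith

/-- The potential generated by a unit current that enters the graph in `x` and leaves it
in `y`. -/
noncomputable def dipole [Fintype E] [Nonempty E] (x y : G.Point) : G.h1 :=
  (exists_dipole x y).choose

/-- The effective resistance between two points. -/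
noncomputable def resistance [Fintype E] [Nonempty E] (x y : G.Point) : ℝ :=
  (dipole x y : G.Point → ℝ) x - (dipole x y : G.Point → ℝ) y

variable [Fintype E] [Nonempty E]

theorem energy_dipole (x y : G.Point) (φ : G.h1) :
    G.energy (dipole x y) φ = (φ : G.Point → ℝ) x - (φ : G.Point → ℝ) y :=
  (exists_dipole x y).choose_spec φ

theorem energy_dipole_self (x y : G.Point) :
    G.energy (dipole x y) (dipole x y) = resistance x y :=
  energy_dipole x y _

theorem resistance_nonneg (x y : G.Point) : 0 ≤ resistance x y := by
  rw [← energy_dipole_self]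
  exact energy_self_nonneg _

theorem sq_sub_le_resistance_mul_energy (f : G.h1) (x y : G.Point) :
    ((f : G.Point → ℝ) x - (f : G.Point → ℝ) y) ^ 2 ≤ resistance x y * G.energy f f := by
  rw [← energy_dipole_self, ← energy_dipole, energy_eq_inner, energy_eq_inner, energy_eq_inner, sq]
  exact real_inner_mul_inner_self_le _ _

/-- Testing with the dipole itself gives `r² ≤ c r`. Together with the Cauchy–Schwarz bound above,
this identifies the resistance as the optimal constant. -/
theorem resistance_le_of_forall {c : ℝ} (x y : G.Point) (hc : 0 ≤ c) (h : ∀ f : G.h1,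
    ((f : G.Point → ℝ) x - (f : G.Point → ℝ) y) ^ 2 ≤ c * G.energy f f) : resistance x y ≤ c := by
  have h1 := h (dipole x y)
  rw [energy_dipole_self, sq] at h1
  change resistance x y * resistance x y ≤ _ at h1
  rcases (resistance_nonneg x y).eq_or_lt with h0 | h0
  · rwa [← h0]
  · exact le_of_mul_le_mul_right h1 h0

theorem resistance_comm (x y : G.Point) : resistance x y = resistance y x := by
  have key : ∀ x y : G.Point, resistance x y ≤ resistance y x := fun x y =>
    resistance_le_of_forall x y (resistance_nonneg y x) fun f => by
      rw [← neg_sub, neg_sq]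
      exact sq_sub_le_resistance_mul_energy f y x
  exact le_antisymm (key x y) (key y x)

theorem resistance_edge_le (e : E) (t t' : Icc (0 : ℝ) (G.len e)) :
    resistance (G.edge e t) (G.edge e t') ≤ |(t : ℝ) - t'| :=
  resistance_le_of_forall _ _ (abs_nonneg _) fun f => sq_sub_edge_le f e t t'

theorem eq_of_energy_self_le_zero {f : G.h1} (h : G.energy f f ≤ 0) (x y : G.Point) :
    (f : G.Point → ℝ) x = (f : G.Point → ℝ) y := by
  have h1 := sq_sub_le_resistance_mul_energy f x y
  have h2 := mul_nonpos_of_nonneg_of_nonpos (resistance_nonneg x y) h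
  exact sub_eq_zero.1 (pow_eq_zero_iff two_ne_zero |>.1 (le_antisymm (h1.trans h2) (sq_nonneg _)))

/-- A contraction of the potential with the same values at `x` and `y` is the potential itself. -/
theorem eq_dipole_of_contraction {x y : G.Point} {g : G.Point → ℝ}
    (h : ∀ z w, |g z - g w| ≤ |(dipole x y : G.Point → ℝ) z - (dipole x y : G.Point → ℝ) w|)
    (hx : g x = (dipole x y : G.Point → ℝ) x) (hy : g y = (dipole x y : G.Point → ℝ) y) :
    g = dipole x y := by
  have hg := mem_H1_of_contraction (dipole x y).2 h
  have he := energy_le_of_contraction (dipole x y).2 h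
  have h1 := energy_dipole x y ⟨g, hg⟩
  have h2 := energy_dipole x y (dipole x y)
  simp only [hx, hy] at h1
  -- Write `d` for the dipole. Since `g` agrees with `d` at `x` and `y`, `q(d, g) = q(d, d)`, so the
  -- left side is `q(g, g) - q(d, d)`.
  have h3 : G.energy (⟨g, hg⟩ - dipole x y : G.h1) (⟨g, hg⟩ - dipole x y : G.h1) ≤ 0 := by
    rw [energy_sub_self]
    simp only
    linarith
  ext z
  have := eq_of_energy_self_le_zero h3 z x
  simp only [Submodule.coe_sub, Pi.sub_apply, hx] at this
  linarith

/-- Maximum principle: truncating the potential at its value at `x` is a contraction that keeps the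
values at `x` and `y`, so it changes nothing. -/
theorem dipole_le_left (x y z : G.Point) :
    (dipole x y : G.Point → ℝ) z ≤ (dipole x y : G.Point → ℝ) x := by
  have h := eq_dipole_of_contraction (x := x) (y := y)
    (g := fun z => min ((dipole x y : G.Point → ℝ) z) ((dipole x y : G.Point → ℝ) x))
    (fun z w => by
      simpa using abs_min_sub_min_le_max ((dipole x y : G.Point → ℝ) z)
        ((dipole x y : G.Point → ℝ) x) ((dipole x y : G.Point → ℝ) w)
        ((dipole x y : G.Point → ℝ) x)) (min_self _)
    (min_eq_left (sub_nonneg.1 (resistance_nonneg x y)))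
  rw [← congrFun h z]
  exact min_le_right _ _

theorem right_le_dipole (x y z : G.Point) :
    (dipole x y : G.Point → ℝ) y ≤ (dipole x y : G.Point → ℝ) z := by
  have h := eq_dipole_of_contraction (x := x) (y := y)
    (g := fun z => max ((dipole x y : G.Point → ℝ) z) ((dipole x y : G.Point → ℝ) y))
    (fun z w => by
      simpa using abs_max_sub_max_le_max ((dipole x y : G.Point → ℝ) z)
        ((dipole x y : G.Point → ℝ) y) ((dipole x y : G.Point → ℝ) w)
        ((dipole x y : G.Point → ℝ) y))
    (max_eq_left (sub_nonneg.1 (resistance_nonneg x y))) (max_self _)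
  rw [← congrFun h z]
  exact le_max_right _ _

/-- By superposition, the dipole from `x` to `z` is the sum of those from `x` to `y` and from `y` to
`z`, up to a constant. By the maximum principle, the drop of each summand between `x` and `z` is at
most its full drop. -/
theorem resistance_triangle (x y z : G.Point) :
    resistance x z ≤ resistance x y + resistance y z := by
  have h : G.energy (dipole x z - dipole x y - dipole y z : G.h1)
      (dipole x z - dipole x y - dipole y z : G.h1) ≤ 0 := by
    rw [energy_sub_left, energy_sub_left, energy_dipole, energy_dipole, energy_dipole]
    linarith
  have h' := eq_of_energy_self_le_zero h x z
  simp only [Submodule.coe_sub, Pi.sub_apply] at h'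
  have h1 := dipole_le_left y z x
  have h2 := right_le_dipole x y z
  unfold resistance
  linarith

theorem resistance_le_of_pathOfLength {x y : G.Point} {s : ℝ} (h : G.PathOfLength x y s) :
    resistance x y ≤ s := by
  induction h with
  | refl x => simp [resistance]
  | cons e t t' y s _ ih =>
    exact (resistance_triangle _ (G.edge e t') _).trans (add_le_add (resistance_edge_le e t t') ih)

theorem resistance_le_pathDist (x y : G.Point) : resistance x y ≤ G.pathDist x y :=
  le_csInf (G.exists_pathOfLength x y) fun _ h => resistance_le_of_pathOfLength h

/-- The test function is the distance to `y`, whose slope is at most 1, so that its energy is at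
most the total length. -/
theorem sq_pathDist_le (x y : G.Point) :
    G.pathDist x y ^ 2 ≤ resistance x y * G.totalLength := by
  have hl := fun e t t' => G.abs_pathDist_edge_sub_le y e t t'
  have h := sq_sub_le_resistance_mul_energy
    (⟨fun z => G.pathDist z y, mem_H1_of_lipschitz hl⟩ : G.h1) x y
  simp only [pathDist_self, sub_zero] at h
  exact h.trans (mul_le_mul_of_nonneg_left (energy_le_totalLength hl) (resistance_nonneg x y))

theorem abs_resistance_sub_le (x x' y y' : G.Point) :
    |resistance x y - resistance x' y'| ≤ resistance x x' + resistance y y' := by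
  have h1 := resistance_triangle x x' y
  have h2 := resistance_triangle x' y' y
  have h3 := resistance_triangle x' x y'
  have h4 := resistance_triangle x y y'
  rw [resistance_comm y' y] at h2
  rw [resistance_comm x' x] at h3
  rw [abs_le]
  constructor <;> linarith

theorem continuous_resistance_edge (e e' : E) :
    Continuous fun z : Icc (0 : ℝ) (G.len e) × Icc (0 : ℝ) (G.len e') =>
      resistance (G.edge e z.1) (G.edge e' z.2) := by
  refine continuous_iff_continuousAt.2 fun z => tendsto_iff_dist_tendsto_zero.2 ?_
  have hc : Continuous fun w : Icc (0 : ℝ) (G.len e) × Icc (0 : ℝ) (G.len e') =>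
      |(w.1 : ℝ) - z.1| + |(w.2 : ℝ) - z.2| := by fun_prop
  have h0 := hc.tendsto z
  simp only [sub_self, abs_zero, add_zero] at h0
  refine squeeze_zero (fun _ => dist_nonneg) (fun w => ?_) h0
  exact (abs_resistance_sub_le _ _ _ _).trans
    (add_le_add (resistance_edge_le _ _ _) (resistance_edge_le _ _ _))

variable (G)

/-- There are finitely many pairs of edges, and on each the resistance is continuous on a product of
compact intervals. -/
theorem exists_resistance_max : ∃ x y : G.Point, ∀ z w : G.Point,
    resistance z w ≤ resistance x y := by
  have h1 : ∀ q : E × E, ∃ z : Icc (0 : ℝ) (G.len q.1) × Icc (0 : ℝ) (G.len q.2),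
      ∀ w : Icc (0 : ℝ) (G.len q.1) × Icc (0 : ℝ) (G.len q.2), resistance (G.edge q.1 w.1) (G.edge q.2 w.2) ≤
        resistance (G.edge q.1 z.1) (G.edge q.2 z.2) := fun q => by
    have : Nonempty (Icc (0 : ℝ) (G.len q.1)) := ⟨⟨0, left_mem_Icc.2 (G.len_pos _).le⟩⟩
    have : Nonempty (Icc (0 : ℝ) (G.len q.2)) := ⟨⟨0, left_mem_Icc.2 (G.len_pos _).le⟩⟩
    obtain ⟨z, -, hz⟩ := isCompact_univ.exists_isMaxOn univ_nonempty
      (continuous_resistance_edge (G := G) q.1 q.2).continuousOn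
    exact ⟨z, fun w => hz (mem_univ w)⟩
  choose z hz using h1
  obtain ⟨q, hq⟩ := Finite.exists_max fun q : E × E =>
    resistance (G.edge q.1 (z q).1) (G.edge q.2 (z q).2)
  refine ⟨G.edge q.1 (z q).1, G.edge q.2 (z q).2, fun a b => ?_⟩
  obtain ⟨e, t, rfl⟩ := G.exists_eq_edge a
  obtain ⟨e', t', rfl⟩ := G.exists_eq_edge b
  exact (hz (e, e') (t, t')).trans (hq (e, e'))

theorem exists_resistance_pos : ∃ x y : G.Point, 0 < resistance x y := by
  classical
  let e := Classical.arbitrary E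
  have hpos := G.len_pos e
  -- A tent on the single edge `e`, zero elsewhere: it is 1-Lipschitz along edges, vanishes at all
  -- vertices and separates the midpoint of `e` from its initial vertex.
  let g : G.Point → ℝ := Quot.lift
    (Sum.elim (fun _ => 0) fun z => if z.1 = e then min (z.2 : ℝ) (G.len z.1 - z.2) else 0) (by
      rintro _ _ (e' | e')
      · simp [(G.len_pos e').le]
      · simp [(G.len_pos e').le])
  have hg : ∀ e' (t : Icc (0 : ℝ) (G.len e')),
      g (G.edge e' t) = if e' = e then min (t : ℝ) (G.len e' - t) else 0 := fun _ _ => rfl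
  have hg1 : g ∈ G.H1 := mem_H1_of_lipschitz fun e' t t' => by
    rw [hg, hg]
    split_ifs
    · refine (abs_min_sub_min_le_max _ _ _ _).trans (max_le le_rfl ?_)
      rw [sub_sub_sub_cancel_left, abs_sub_comm]
    · simp
  refine ⟨G.edge e ⟨G.len e / 2, by positivity, by linarith⟩, G.vertex (G.src e),
    (resistance_nonneg _ _).lt_of_ne fun h0 => ?_⟩
  have h := sq_sub_le_resistance_mul_energy (⟨g, hg1⟩ : G.h1)
    (G.edge e ⟨G.len e / 2, by positivity, by linarith⟩) (G.vertex (G.src e))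
  rw [← h0, zero_mul] at h
  have hv : g (G.vertex (G.src e)) = 0 := rfl
  simp only [hg, hv, if_true] at h
  rw [min_eq_left (by linarith)] at h
  nlinarith

end MetricGraph

/-! ### The two-point measure -/

namespace MetricGraph

variable {V : Type*} {E : Type*} {G : MetricGraph V E}

section TwoPointMeasure

variable (x y : G.Point)

/-- The probability measure with mass `1/2` at each of two points. -/
noncomputable def twoPointMeasure : ProbabilityMeasure G.Point :=
  ⟨(2⁻¹ : ENNReal) • (Measure.dirac x + Measure.dirac y), ⟨by
    simp only [Measure.smul_apply, Measure.add_apply, measure_univ, smul_eq_mul, one_add_one_eq_two]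
    exact ENNReal.inv_mul_cancel two_ne_zero ENNReal.ofNat_ne_top⟩⟩

theorem coe_twoPointMeasure : (twoPointMeasure x y : Measure G.Point) =
    (2⁻¹ : ENNReal) • (Measure.dirac x + Measure.dirac y) := rfl

theorem integral_twoPointMeasure {f : G.Point → ℝ} (hf : Measurable f) :
    ∫ z, f z ∂(twoPointMeasure x y : Measure G.Point) = (f x + f y) / 2 := by
  have hi : ∀ z, Integrable f (Measure.dirac z) := fun z =>
    integrable_dirac' hf.stronglyMeasurable (by simp)
  rw [coe_twoPointMeasure, integral_smul_measure, integral_add_measure (hi x) (hi y),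
    integral_dirac' _ _ hf.stronglyMeasurable, integral_dirac' _ _ hf.stronglyMeasurable]
  simp
  ring

/-- This inclusion suffices: a function vanishing on the support vanishes at `x` and `y`, and the
energy pairing with the dipole only sees these two values. -/
theorem mem_support_twoPointMeasure :
    x ∈ (twoPointMeasure x y : Measure G.Point).support ∧
      y ∈ (twoPointMeasure x y : Measure G.Point).support := by
  have hd : ∀ (z : G.Point) (U : Set G.Point), U ∈ nhds z → 0 < Measure.dirac z U := fun z U hU =>
    lt_of_lt_of_le (by simp [mem_of_mem_nhds hU]) Measure.le_dirac_apply
  simp only [Measure.mem_support_iff_forall, coe_twoPointMeasure, Measure.smul_apply,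
    Measure.add_apply, smul_eq_mul]
  refine ⟨fun U hU => ENNReal.mul_pos (by simp) ?_, fun U hU => ENNReal.mul_pos (by simp) ?_⟩
  · exact ((hd x U hU).trans_le le_self_add).ne'
  · exact ((hd y U hU).trans_le le_add_self).ne'

end TwoPointMeasure

/-! ### Lower bound for the first eigenvalue of every measure -/

variable [Fintype E]

theorem grad_const (c : ℝ) : G.grad ⟨fun _ => c, const_mem_H1 c⟩ = 0 := by
  rw [← inner_self_eq_zero (𝕜 := ℝ), ← energy_eq_inner, energy_self_eq_sum (const_mem_H1 c)]
  refine Finset.sum_eq_zero fun e _ => ?_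
  have : ∀ s, deriv (G.restrictEdge (fun _ => c) e) s = 0 := fun s => deriv_const s c
  simp [this]

theorem energy_const_left (c : ℝ) {f : G.Point → ℝ} (hf : f ∈ G.H1) :
    G.energy (fun _ => c) f = 0 := by
  rw [energy_eq_inner ⟨_, const_mem_H1 c⟩ ⟨f, hf⟩, grad_const, inner_zero_left]

theorem energy_const_right (c : ℝ) {f : G.Point → ℝ} (hf : f ∈ G.H1) :
    G.energy f (fun _ => c) = 0 := by
  rw [energy_eq_inner ⟨f, hf⟩ ⟨_, const_mem_H1 c⟩, grad_const, inner_zero_right]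

theorem const_mem_H1Measure (μ : Measure G.Point) (c : ℝ) : (fun _ => c) ∈ G.H1Measure μ :=
  ⟨const_mem_H1 c, const_mem_H1 c, fun _ hg _ => energy_const_left c hg⟩

theorem isEigenfunction_one [Nonempty E] (μ : Measure G.Point) : G.IsEigenfunction μ 0 1 := by
  obtain ⟨e⟩ := ‹Nonempty E›
  refine ⟨fun h => one_ne_zero (congrFun h (G.vertex (G.src e))), const_mem_H1Measure μ 1, ?_, ?_⟩
  · rw [zero_smul]
    exact MemLp.zero
  · intro φ hφ
    rw [zero_smul]
    simp only [Pi.zero_apply, zero_mul, integral_zero]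
    exact energy_const_left 1 hφ.1

/-- Popoviciu's inequality: a random variable with values in an interval of length `D` has variance
at most `D² / 4`. This is the source of the factor 4. -/
theorem integral_sq_le [Nonempty E] {C : ℝ} {f : G.Point → ℝ} (hf : f ∈ G.H1)
    (hC : ∀ x y, (f x - f y) ^ 2 ≤ C * G.energy f f) (μ : Measure G.Point)
    [IsProbabilityMeasure μ] (h0 : ∫ x, f x ∂μ = 0) :
    ∫ x, f x ^ 2 ∂μ ≤ C * G.energy f f / 4 := by
  have e := Classical.arbitrary E
  have hne : Nonempty G.Point := ⟨G.vertex (G.src e)⟩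
  have hq : 0 ≤ C * G.energy f f :=
    (sq_nonneg _).trans (hC (G.vertex (G.src e)) (G.vertex (G.src e)))
  have hD : ∀ x y, f x - Real.sqrt (C * G.energy f f) ≤ f y := fun x y => by
    have := Real.le_sqrt_of_sq_le (hC x y)
    linarith
  have hm := hf.1.measurable.aemeasurable (μ := μ)
  have hb : BddBelow (range f) :=
    ⟨f (G.vertex (G.src e)) - Real.sqrt (C * G.energy f f), by rintro _ ⟨y, rfl⟩; exact hD _ y⟩
  have h := ProbabilityTheory.variance_le_sq_of_bounded (μ := μ) (X := f) (a := ⨅ x, f x)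
    (b := (⨅ x, f x) + Real.sqrt (C * G.energy f f))
    (Filter.Eventually.of_forall fun x =>
      ⟨ciInf_le hb x, by linarith [le_ciInf (hD x)]⟩) hm
  rw [ProbabilityTheory.variance_of_integral_eq_zero hm h0, add_sub_cancel_left, div_pow,
    Real.sq_sqrt hq] at h
  linarith

/-- For `s ≠ 0`, testing with 1 gives mean zero and testing with `f` gives `q(f, f) = s ∫ f²`; the
variance bound then yields `q(f, f) ≤ (s C / 4) q(f, f)`. -/
theorem IsEigenfunction.eq_zero_or_le [Nonempty E] {C : ℝ} (hC0 : 0 < C)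
    (hC : ∀ f ∈ G.H1, ∀ x y, (f x - f y) ^ 2 ≤ C * G.energy f f) {μ : Measure G.Point}
    [IsProbabilityMeasure μ] {s : ℝ} {f : G.Point → ℝ} (h : G.IsEigenfunction μ s f) :
    s = 0 ∨ 4 / C ≤ s := by
  obtain ⟨hne, hf, -, hs⟩ := h
  refine or_iff_not_imp_left.2 fun hs0 => ?_
  have hmean := hs _ (const_mem_H1Measure μ 1)
  simp only [Pi.smul_apply, smul_eq_mul, mul_one, integral_const_mul,
    energy_const_right 1 hf.1] at hmean
  have hmean : ∫ x, f x ∂μ = 0 := (mul_eq_zero.1 hmean.symm).resolve_left hs0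
  have hsq := integral_sq_le hf.1 (hC f hf.1) μ hmean
  have hself := hs f hf
  simp only [Pi.smul_apply, smul_eq_mul, mul_assoc, integral_const_mul, ← sq] at hself
  have hint : 0 ≤ ∫ x, f x ^ 2 ∂μ := integral_nonneg fun x => sq_nonneg _
  have hq : 0 ≤ G.energy f f := energy_self_nonneg ⟨f, hf.1⟩
  -- Zero energy would make `f` constant, hence zero because its mean is zero.
  have hqpos : 0 < G.energy f f := by
    refine hq.lt_of_ne fun h0 => hne ?_
    have hconst : ∀ x y, f x = f y := fun x y => by
      have := hC f hf.1 x y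
      rw [← h0, mul_zero] at this
      exact sub_eq_zero.1 (pow_eq_zero_iff two_ne_zero |>.1 (le_antisymm this (sq_nonneg _)))
    ext x
    have : ∫ y, f y ∂μ = f x := by
      rw [integral_congr_ae (Filter.Eventually.of_forall fun y => hconst y x)]
      simp
    rw [← this, hmean, Pi.zero_apply]
  have hspos : 0 < s := by
    by_contra hneg
    exact hqpos.not_ge (hself ▸ mul_nonpos_of_nonpos_of_nonneg (not_lt.1 hneg) hint)
  rw [div_le_iff₀ hC0]
  have := mul_le_mul_of_nonneg_left hsq hspos.le
  rw [← hself] at this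
  nlinarith

theorem IsEigenfunction.eq_const_of_eq_zero {C : ℝ}
    (hC : ∀ f ∈ G.H1, ∀ x y, (f x - f y) ^ 2 ≤ C * G.energy f f) {μ : Measure G.Point}
    {f : G.Point → ℝ} (h : G.IsEigenfunction μ 0 f) (x y : G.Point) : f x = f y := by
  obtain ⟨-, hf, -, hs⟩ := h
  have h0 := hs f hf
  simp only [zero_smul, Pi.zero_apply, zero_mul, integral_zero] at h0
  have := hC f hf.1 x y
  rw [h0, mul_zero] at this
  exact sub_eq_zero.1 (pow_eq_zero_iff two_ne_zero |>.1 (le_antisymm this (sq_nonneg _)))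

/-- Below `4 / C` the only possible eigenvalue is 0, whose eigenfunctions are constant, and two
constants are linearly dependent. -/
theorem le_eigenvalue_one [Nonempty E] {C : ℝ} (hC0 : 0 < C)
    (hC : ∀ f ∈ G.H1, ∀ x y, (f x - f y) ^ 2 ≤ C * G.energy f f) (μ : Measure G.Point)
    [IsProbabilityMeasure μ] : ((4 / C : ℝ) : EReal) ≤ G.eigenvalue μ 1 := by
  refine le_sInf ?_
  rintro _ ⟨t, rfl, f, hlin, hf⟩
  rw [EReal.coe_le_coe_iff]
  by_contra! ht
  have hconst : ∀ i x y, f i x = f i y := fun i x y => by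
    obtain ⟨s, hs, hfs⟩ := hf i
    rcases hfs.eq_zero_or_le hC0 hC with rfl | h
    · exact hfs.eq_const_of_eq_zero hC x y
    · linarith
  let z := G.vertex (G.src (Classical.arbitrary E))
  obtain ⟨s, -, hne, -⟩ := hf 0
  have hpair : LinearIndependent ℝ ![f 0, f 1] := by
    convert hlin using 1
    ext i
    fin_cases i <;> rfl
  have h0 := LinearIndependent.pair_iff.1 hpair (f 1 z) (-f 0 z) (by
    ext x
    simp only [Pi.add_apply, Pi.smul_apply, smul_eq_mul, Pi.zero_apply, hconst _ x z]
    ring)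
  refine hne (funext fun x => ?_)
  rw [hconst 0 x z, Pi.zero_apply]
  exact neg_eq_zero.1 h0.2

/-! ### The dipole as an eigenfunction of the two-point measure -/

section TwoPoint

variable [Nonempty E] (x y : G.Point)

/-- The potential of a unit current from `x` to `y`, normalized to have opposite values at `x`
and `y`. -/
noncomputable def centeredDipole : G.h1 :=
  dipole x y - ⟨fun _ => ((dipole x y : G.Point → ℝ) x + (dipole x y : G.Point → ℝ) y) / 2,
    const_mem_H1 _⟩

theorem centeredDipole_left : (centeredDipole x y : G.Point → ℝ) x = resistance x y / 2 := by
  simp only [centeredDipole, Submodule.coe_sub, Pi.sub_apply, resistance]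
  ring

theorem centeredDipole_right : (centeredDipole x y : G.Point → ℝ) y = -(resistance x y / 2) := by
  simp only [centeredDipole, Submodule.coe_sub, Pi.sub_apply, resistance]
  ring

theorem energy_centeredDipole {φ : G.Point → ℝ} (hφ : φ ∈ G.H1) :
    G.energy (centeredDipole x y) φ = φ x - φ y := by
  rw [centeredDipole, energy_sub_left _ _ ⟨φ, hφ⟩, energy_dipole, energy_const_left _ hφ, sub_zero]

theorem abs_centeredDipole_le (z : G.Point) :
    |(centeredDipole x y : G.Point → ℝ) z| ≤ resistance x y / 2 := by
  have h1 := dipole_le_left x y z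
  have h2 := right_le_dipole x y z
  simp only [centeredDipole, Submodule.coe_sub, Pi.sub_apply, resistance]
  rw [abs_le]
  constructor <;> linarith

theorem isEigenfunction_centeredDipole (h : 0 < resistance x y) :
    G.IsEigenfunction (twoPointMeasure x y : Measure G.Point) (4 / resistance x y)
      (centeredDipole x y) := by
  have hm : Measurable (centeredDipole x y : G.Point → ℝ) := (centeredDipole x y).2.1.measurable
  have hs := mem_support_twoPointMeasure x y
  refine ⟨fun h0 => ?_, ⟨(centeredDipole x y).2, (centeredDipole x y).2, fun g hg hg0 => ?_⟩, ?_,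
    fun φ hφ => ?_⟩
  · have := centeredDipole_left x y
    rw [h0, Pi.zero_apply] at this
    linarith
  · rw [energy_centeredDipole x y hg, hg0 x (fun hx => hx hs.1), hg0 y (fun hy => hy hs.2), sub_zero]
  · exact (MemLp.of_bound hm.aestronglyMeasurable _
      (Filter.Eventually.of_forall (abs_centeredDipole_le x y))).const_smul _
  -- With values `± r/2` at the two points and masses `1/2`, the integral is `(4/r) · (r/2) · (φ x -
  -- φ y) / 2 = φ x - φ y`.
  · rw [energy_centeredDipole x y hφ.1,
      integral_twoPointMeasure x y
        (f := fun z => ((4 / resistance x y) • (centeredDipole x y : G.Point → ℝ)) z * φ z)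
        ((hm.const_smul (4 / resistance x y)).mul hφ.1.1.measurable)]
    simp only [Pi.smul_apply, smul_eq_mul, centeredDipole_left, centeredDipole_right]
    field_simp
    ring

theorem eigenvalue_one_twoPointMeasure_le (h : 0 < resistance x y) :
    G.eigenvalue (twoPointMeasure x y : Measure G.Point) 1 ≤ ((4 / resistance x y : ℝ) : EReal) := by
  refine sInf_le ⟨_, rfl, ![1, centeredDipole x y], ?_, ?_⟩
  · rw [LinearIndependent.pair_iff]
    intro a b hab
    have hx := congrFun hab x
    have hy := congrFun hab y
    simp only [Pi.add_apply, Pi.smul_apply, Pi.one_apply, smul_eq_mul, mul_one, Pi.zero_apply,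
      centeredDipole_left, centeredDipole_right] at hx hy
    have ha : a = 0 := by linarith
    refine ⟨ha, ?_⟩
    rw [ha, zero_add] at hx
    exact (mul_eq_zero.1 hx).resolve_right (by positivity)
  · intro i
    fin_cases i
    · exact ⟨0, by positivity, isEigenfunction_one _⟩
    · exact ⟨_, le_rfl, isEigenfunction_centeredDipole x y h⟩

end TwoPoint

/-! ### Comparison with the diameter -/

theorem pathDist_le_sqrt [Nonempty E] {C : ℝ} (hC : ∀ z w : G.Point, resistance z w ≤ C)
    (x y : G.Point) : G.pathDist x y ≤ Real.sqrt (C * G.totalLength) :=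
  Real.le_sqrt_of_sq_le ((sq_pathDist_le x y).trans (mul_le_mul_of_nonneg_right (hC x y)
    (Finset.sum_nonneg fun e _ => (G.len_pos e).le)))

/-- The real `sSup` defaults to 0 on unbounded sets, so a bound on all distances is needed; `√(C L)`
serves. -/
theorem le_pathDiam [Nonempty E] {C : ℝ} (hC : ∀ z w : G.Point, resistance z w ≤ C)
    (x y : G.Point) : G.pathDist x y ≤ G.pathDiam :=
  le_csSup ⟨Real.sqrt (C * G.totalLength), by
    rintro _ ⟨x, y, rfl⟩
    exact pathDist_le_sqrt hC x y⟩ ⟨x, y, rfl⟩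

theorem pathDiam_le_sqrt [Nonempty E] {C : ℝ} (hC : ∀ z w : G.Point, resistance z w ≤ C) :
    G.pathDiam ≤ Real.sqrt (C * G.totalLength) :=
  Real.sSup_le (by rintro _ ⟨x, y, rfl⟩; exact pathDist_le_sqrt hC x y) (Real.sqrt_nonneg _)

end MetricGraph

open MetricGraph in
theorem mainTheorem10 {V E : Type*} [Finite V] [Fintype E] [Nonempty E] (G : MetricGraph V E) :
    (∃ μ : ProbabilityMeasure G.Point,
      G.eigenvalue (μ : Measure G.Point) 1 = G.optimalEigenvalue 1) ∧
    ((4 * G.totalLength / G.pathDiam ^ 2 : ℝ) : EReal) ≥ G.optimalEigenvalue 1 ∧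
    G.optimalEigenvalue 1 ≥ ((4 / G.pathDiam : ℝ) : EReal) := by
  obtain ⟨x, y, hmax⟩ := exists_resistance_max G
  have hpos : 0 < resistance x y := by
    obtain ⟨z, w, h⟩ := exists_resistance_pos G
    exact h.trans_le (hmax z w)
  have hC : ∀ f ∈ G.H1, ∀ z w, (f z - f w) ^ 2 ≤ resistance x y * G.energy f f :=
    fun f hf z w => (sq_sub_le_resistance_mul_energy ⟨f, hf⟩ z w).trans
      (mul_le_mul_of_nonneg_right (hmax z w) (energy_self_nonneg ⟨f, hf⟩))
  have hlow : ((4 / resistance x y : ℝ) : EReal) ≤ G.optimalEigenvalue 1 :=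
    le_iInf fun μ => le_eigenvalue_one hpos hC μ
  have hup := eigenvalue_one_twoPointMeasure_le x y hpos
  have hopt : G.optimalEigenvalue 1 ≤ G.eigenvalue (twoPointMeasure x y : Measure G.Point) 1 :=
    iInf_le _ _
  have heq : G.optimalEigenvalue 1 = ((4 / resistance x y : ℝ) : EReal) :=
    le_antisymm (hopt.trans hup) hlow
  have hdiam : resistance x y ≤ G.pathDiam :=
    (resistance_le_pathDist x y).trans (le_pathDiam hmax x y)
  have hdpos : 0 < G.pathDiam := hpos.trans_le hdiam
  refine ⟨⟨twoPointMeasure x y, le_antisymm (hup.trans hlow) hopt⟩, ?_, ?_⟩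
  · rw [heq, ge_iff_le, EReal.coe_le_coe_iff, div_le_div_iff₀ hpos (by positivity)]
    have h := (Real.le_sqrt' hdpos).1 (pathDiam_le_sqrt hmax)
    linarith
  · rw [heq, ge_iff_le, EReal.coe_le_coe_iff]
    gcongr
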